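/- \textbf{Conventions.} A \emph{surface} $\Sigma$ is a smooth, oriented, second countable, Hausdorff $2$-manifold without boundary, not necessarily connected. A \emph{knot} in $\Sigma\times\mathbb{R}$ is a smooth embedding $K:\mathbb{S}^1\to\Sigma\times\mathbb{R}$, and $\mathbb{K}(\Sigma)$ is the set of all of them, with the topology pulled back along the $\infty$-jet prolongation $j^\infty:\mathbb{K}(\Sigma)\to C^0(\mathbb{S}^1,J^\infty(\mathbb{S}^1,\Sigma\times\mathbb{R}))$ from the compact-open topology. An orientation preserving smooth embedding $\psi:\Sigma_1\to\Sigma_2$ induces $\Psi:\mathbb{K}(\Sigma_1)\to\mathbb{K}(\Sigma_2)$, $\Psi(K)=(\psi\times\mathrm{id})\circ K$. The category $\mathbf{VK}$ has as objects the open sets $U\subseteq\mathbb{K}(\Sigma)$, where $\Sigma$ ranges over all surfaces. An arrow from $U_1\subseteq\mathbb{K}(\Sigma_1)$ to $U_2\subseteq\mathbb{K}(\Sigma_2)$ is a function $U_1\to U_2$ that is the restriction of some such $\Psi$ with $\Psi(U_1)\subseteq U_2$ (arrows that agree as functions are equal). A sieve $S$ on $U$ belongs to the Grothendieck topology $J_{\mathbf{VK}}$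 if $U=\bigcup_{(\Psi:V\to U)\in S}\Psi(V)$. Let $\mathrm{Sh}(\mathbf{VK})$ be the topos of sheaves of sets on $(\mathbf{VK},J_{\mathbf{VK}})$, where $\mathbf{Sets}$ is taken large enough for $\mathbf{VK}$ to be small. A \emph{virtual knot} is an isomorphism class of geometric morphisms $p:\mathbf{Sets}\to\mathrm{Sh}(\mathbf{VK})$, i.e. of adjunctions $p^*\dashv p_*$ with $p^*:\mathrm{Sh}(\mathbf{VK})\to\mathbf{Sets}$ left exact; morphisms $p\to q$ are natural transformations $p^*\to q^*$. A \emph{variable-space knot} is a connected component of the category of elements $\int_{\mathbf{VK}}F$ of the forgetful functor $F:\mathbf{VK}\to\mathbf{Sets}$, which sends $U$ to its set of knots. For a geometric morphism $p$ let $A_p:\mathbf{VK}\to\mathbf{Sets}$ be $A_p(U)=p^*(\mathbf{a}\,\mathbf{y}U)$, where $\mathbf{a}\,\mathbf{y}U$ is the sheaf associated to the presheaf represented by $U$. An element $u\in A_p(U)$ \emph{determines} the knot $K\in U$ if $$\bigcap\{\Psi(V)\;:\;\Psi:V\to U \text{ an arrow of } \mathbf{VK},\ u\in\operatorname{im}A_p(\Psi)\}=\{K\}.$$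 \textbf{Theorem.} Variable-space knots are in one-to-one correspondence with virtual knots. More precisely, there is a bijection $e$ from the set of virtual knots to the set of variable-space knots such that, for every geometric morphism $p:\mathbf{Sets}\to\mathrm{Sh}(\mathbf{VK})$, every object $U$ of $\mathbf{VK}$ and every knot $K\in U$, the object $(U,K)$ of $\int_{\mathbf{VK}}F$ lies in the component $e([p])$ if and only if $K$ is determined by some $u\in A_p(U)$. -/

import Mathlib

open CategoryTheory Limits Opposite Topology
open scoped Manifold ContDiff

noncomputable section

namespace VirtualKnots

/-! ## Smooth embeddings and oriented surfaces -/

/-- A smooth embedding: a smooth immersion (the differential is injective at every point) which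
is a homeomorphism onto its image. -/
structure IsSmoothEmb {E : Type*} [NormedAddCommGroup E] [NormedSpace ℝ E] {H : Type*}
    [TopologicalSpace H] (I : ModelWithCorners ℝ E H) {E' : Type*} [NormedAddCommGroup E']
    [NormedSpace ℝ E'] {H' : Type*} [TopologicalSpace H'] (I' : ModelWithCorners ℝ E' H')
    {M : Type*} [TopologicalSpace M] [ChartedSpace H M] {N : Type*} [TopologicalSpace N]
    [ChartedSpace H' N] (f : M → N) : Prop where
  contMDiff : ContMDiff I I' ∞ f
  immersion : ∀ x, Function.Injective (mfderiv I I' f x)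
  isEmbedding : IsEmbedding f

theorem IsSmoothEmb.comp {E : Type*} [NormedAddCommGroup E] [NormedSpace ℝ E] {H : Type*}
    [TopologicalSpace H] {I : ModelWithCorners ℝ E H} {E' : Type*} [NormedAddCommGroup E']
    [NormedSpace ℝ E'] {H' : Type*} [TopologicalSpace H'] {I' : ModelWithCorners ℝ E' H'}
    {E'' : Type*} [NormedAddCommGroup E'']
    [NormedSpace ℝ E''] {H'' : Type*} [TopologicalSpace H''] {I'' : ModelWithCorners ℝ E'' H''}
    {M : Type*} [TopologicalSpace M] [ChartedSpace H M] {N : Type*} [TopologicalSpace N]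
    [ChartedSpace H' N] {P : Type*} [TopologicalSpace P] [ChartedSpace H'' P]
    {g : N → P} {f : M → N} (hg : IsSmoothEmb I' I'' g) (hf : IsSmoothEmb I I' f) :
    IsSmoothEmb I I'' (g ∘ f) where
  contMDiff := hg.contMDiff.comp hf.contMDiff
  immersion x := by
    rw [mfderiv_comp x (hg.contMDiff.mdifferentiable (by simp) _)
      (hf.contMDiff.mdifferentiable (by simp) _)]
    exact (hg.immersion (f x)).comp (hf.immersion x)
  isEmbedding := hg.isEmbedding.comp hf.isEmbedding

/-- The Euclidean plane. -/
abbrev Plane : Type := EuclideanSpace ℝ (Fin 2)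

/-- A smooth oriented surface without boundary: a second countable Hausdorff smooth 2-manifold,
not necessarily connected, with an orientation given by an oriented atlas (all transition maps have
positive Jacobian determinant). -/
structure OrientedSurface : Type 1 where
  carrier : Type
  [top : TopologicalSpace carrier]
  [t2 : T2Space carrier]
  [secondCountable : SecondCountableTopology carrier]
  [charted : ChartedSpace Plane carrier]
  [isManifold : IsManifold (𝓡 2) ∞ carrier]
  oriented : ∀ e ∈ atlas Plane carrier, ∀ e' ∈ atlas Plane carrier,
    ∀ x ∈ (e.symm.trans e').source, 0 < (fderiv ℝ (e.symm.trans e') x).det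

instance : CoeSort OrientedSurface Type := ⟨OrientedSurface.carrier⟩

attribute [instance] OrientedSurface.top OrientedSurface.t2 OrientedSurface.secondCountable
  OrientedSurface.charted OrientedSurface.isManifold

/-- An orientation preserving smooth embedding of oriented surfaces. The determinant is that of the
differential written in the oriented charts at `x` and at the image of `x`. -/
structure SurfaceEmb (S T : OrientedSurface) where
  toFun : S → T
  isSmoothEmb : IsSmoothEmb (𝓡 2) (𝓡 2) toFun
  orientationPreserving :
    ∀ x, 0 < ContinuousLinearMap.det (mfderiv (𝓡 2) (𝓡 2) toFun x : Plane →L[ℝ] Plane)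

theorem det_mfderiv_comp {S T R : OrientedSurface} (g : T → R) (f : S → T)
    (hg : ContMDiff (𝓡 2) (𝓡 2) ∞ g) (hf : ContMDiff (𝓡 2) (𝓡 2) ∞ f) (x : S) :
    ContinuousLinearMap.det (mfderiv (𝓡 2) (𝓡 2) (g ∘ f) x : Plane →L[ℝ] Plane) =
      ContinuousLinearMap.det (mfderiv (𝓡 2) (𝓡 2) g (f x) : Plane →L[ℝ] Plane) *
      ContinuousLinearMap.det (mfderiv (𝓡 2) (𝓡 2) f x : Plane →L[ℝ] Plane) := by
  rw [mfderiv_comp x (hg.mdifferentiable (by simp) _) (hf.mdifferentiable (by simp) _)]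
  exact LinearMap.det_comp
    (mfderiv (𝓡 2) (𝓡 2) g (f x) : Plane →L[ℝ] Plane).toLinearMap
    (mfderiv (𝓡 2) (𝓡 2) f x : Plane →L[ℝ] Plane).toLinearMap

/-- The identity embedding. -/
def SurfaceEmb.id (S : OrientedSurface) : SurfaceEmb S S where
  toFun := _root_.id
  isSmoothEmb :=
    { contMDiff := contMDiff_id
      immersion := fun x => by
        rw [mfderiv_id]
        exact Function.injective_id
      isEmbedding := IsEmbedding.id }
  orientationPreserving x := by
    rw [mfderiv_id]
    have : ContinuousLinearMap.det (ContinuousLinearMap.id ℝ Plane) = 1 := LinearMap.det_id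
    exact this ▸ one_pos

/-- Composition of embeddings. -/
def SurfaceEmb.comp {S T R : OrientedSurface} (g : SurfaceEmb T R) (f : SurfaceEmb S T) :
    SurfaceEmb S R where
  toFun := g.toFun ∘ f.toFun
  isSmoothEmb := g.isSmoothEmb.comp f.isSmoothEmb
  orientationPreserving x := by
    rw [det_mfderiv_comp _ _ g.isSmoothEmb.contMDiff f.isSmoothEmb.contMDiff]
    exact mul_pos (g.orientationPreserving _) (f.orientationPreserving _)

/-! ## Knots in thickened surfaces -/

/-- The model with corners of the thickened surface `S × ℝ`. -/
abbrev thickModel : ModelWithCorners ℝ (Plane × ℝ) (ModelProd Plane ℝ) :=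
  (𝓡 2).prod 𝓘(ℝ, ℝ)

/-- The map `ψ × id` of thickened surfaces. -/
def SurfaceEmb.thicken {S T : OrientedSurface} (ψ : SurfaceEmb S T) : S × ℝ → T × ℝ :=
  Prod.map ψ.toFun _root_.id

theorem SurfaceEmb.isSmoothEmb_thicken {S T : OrientedSurface} (ψ : SurfaceEmb S T) :
    IsSmoothEmb thickModel thickModel ψ.thicken where
  contMDiff := ψ.isSmoothEmb.contMDiff.prodMap contMDiff_id
  immersion p := by
    have h : mfderiv thickModel thickModel ψ.thicken p =
        (mfderiv (𝓡 2) (𝓡 2) ψ.toFun p.1).prodMap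
          (mfderiv 𝓘(ℝ, ℝ) 𝓘(ℝ, ℝ) (_root_.id : ℝ → ℝ) p.2) :=
      mfderiv_prodMap (ψ.isSmoothEmb.contMDiff.mdifferentiable (by simp) _) mdifferentiableAt_id
    rw [h, mfderiv_id]
    exact Function.Injective.prodMap (ψ.isSmoothEmb.immersion p.1) Function.injective_id
  isEmbedding := ψ.isSmoothEmb.isEmbedding.prodMap IsEmbedding.id

/-- A knot in the thickened surface `S × ℝ`: a smooth embedding of the circle. -/
@[ext]
structure Knot (S : OrientedSurface) where
  toFun : Circle → S × ℝ
  isSmoothEmb : IsSmoothEmb (𝓡 1) thickModel toFun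

/-- Subbasic open sets of the space of knots: the knots whose jets over the compact set `C` of
angles have base value in the domain of the smooth chart `c` and `k`-th derivative, in that
chart, in `Ω`. -/
def Knot.subbasic {S : OrientedSurface} (c : OpenPartialHomeomorph (S × ℝ) (ModelProd Plane ℝ))
    (C : Set ℝ) (k : ℕ) (Ω : Set (Plane × ℝ)) : Set (Knot S) :=
  {K | ∀ θ ∈ C, K.toFun (Circle.exp θ) ∈ c.source ∧
    iteratedDeriv k (fun t : ℝ => c.extend thickModel (K.toFun (Circle.exp t))) θ ∈ Ω}

/-- The topology of the space of knots in `S × ℝ`: the pullback, along the infinite jet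
prolongation `K ↦ j^∞ K`, of the compact-open topology on continuous maps from the circle to the
space of infinite jets. The jet space carries its usual charts (derivatives of all orders with
respect to the angle, in a smooth chart `c` of `S × ℝ`), so this topology is generated by the
sets `Knot.subbasic c C k Ω` with `c` a smooth chart, `C` compact and `Ω` open. -/
instance (S : OrientedSurface) : TopologicalSpace (Knot S) :=
  TopologicalSpace.generateFrom
    {N | ∃ c ∈ IsManifold.maximalAtlas thickModel ∞ (S × ℝ), ∃ C : Set ℝ, IsCompact C ∧
      ∃ (k : ℕ) (Ω : Set (Plane × ℝ)), IsOpen Ω ∧ N = Knot.subbasic c C k Ω}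

/-- The map of knot spaces `K ↦ (ψ × id) ∘ K` induced by an embedding `ψ` of surfaces. -/
def Knot.map {S T : OrientedSurface} (ψ : SurfaceEmb S T) (K : Knot S) : Knot T where
  toFun := ψ.thicken ∘ K.toFun
  isSmoothEmb := ψ.isSmoothEmb_thicken.comp K.isSmoothEmb

theorem Knot.map_id {S : OrientedSurface} (K : Knot S) : K.map (SurfaceEmb.id S) = K := rfl

theorem Knot.map_comp {S T R : OrientedSurface} (g : SurfaceEmb T R) (f : SurfaceEmb S T)
    (K : Knot S) : K.map (g.comp f) = (K.map f).map g := rfl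

theorem Knot.map_injective {S T : OrientedSurface} (ψ : SurfaceEmb S T) :
    Function.Injective (Knot.map ψ) := by
  intro K L h
  ext1
  have h' : ψ.thicken ∘ K.toFun = ψ.thicken ∘ L.toFun := congrArg Knot.toFun h
  exact ψ.isSmoothEmb_thicken.isEmbedding.injective.comp_left h'

/-! ## Embeddings of surfaces are open, with smooth inverse on the image -/

theorem SurfaceEmb.local_inverse {S T : OrientedSurface} (ψ : SurfaceEmb S T) (x : S) :
    Filter.map ψ.toFun (𝓝 x) = 𝓝 (ψ.toFun x) ∧
      ∀ g : T → S, Function.LeftInverse g ψ.toFun →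
        ContMDiffAt (𝓡 2) (𝓡 2) ∞ g (ψ.toFun x) := by
  have hsm : ContMDiffAt (𝓡 2) (𝓡 2) ∞ ψ.toFun x := ψ.isSmoothEmb.contMDiff x
  set f : Plane → Plane := writtenInExtChartAt (𝓡 2) (𝓡 2) x ψ.toFun with hf
  set a : Plane := extChartAt (𝓡 2) x x with ha
  set b : Plane := extChartAt (𝓡 2) (ψ.toFun x) (ψ.toFun x) with hb
  have hfa : f a = b := by simp [hf, ha, hb, writtenInExtChartAt]
  have hcd : ContDiffAt ℝ ∞ f a := by
    have := (contMDiffAt_iff.1 hsm).2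
    rw [ModelWithCorners.range_eq_univ, contDiffWithinAt_univ] at this
    exact this
  have hdet := ψ.orientationPreserving x
  set A : Plane →L[ℝ] Plane := mfderiv (𝓡 2) (𝓡 2) ψ.toFun x with hA
  let A' : Plane ≃L[ℝ] Plane := A.toContinuousLinearEquivOfDetNeZero hdet.ne'
  have hder : HasFDerivAt f (A' : Plane →L[ℝ] Plane) a := by
    have h : HasFDerivWithinAt f A (Set.range (𝓡 2)) a :=
      (hsm.mdifferentiableAt (by simp)).hasMFDerivAt.2
    rw [ModelWithCorners.range_eq_univ, hasFDerivWithinAt_univ] at h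
    have hAA : (A' : Plane →L[ℝ] Plane) = A := by ext1 v; rfl
    rw [hAA]; exact h
  have hstrict := hcd.hasStrictFDerivAt' hder (by simp)
  have hmapf : Filter.map f (𝓝 a) = 𝓝 b := by rw [hstrict.map_nhds_eq_of_equiv, hfa]
  have hsource : ∀ᶠ y in 𝓝 x, y ∈ (extChartAt (𝓡 2) x).source :=
    extChartAt_source_mem_nhds x
  have hsource' : ∀ᶠ y in 𝓝 x, ψ.toFun y ∈ (extChartAt (𝓡 2) (ψ.toFun x)).source :=
    hsm.continuousAt (extChartAt_source_mem_nhds (ψ.toFun x))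
  have hfx : ∀ᶠ y in 𝓝 x, f (extChartAt (𝓡 2) x y) = extChartAt (𝓡 2) (ψ.toFun x) (ψ.toFun y) := by
    filter_upwards [hsource] with y hy
    simp only [hf, writtenInExtChartAt, Function.comp_apply, (extChartAt (𝓡 2) x).left_inv hy]
  have hmapx : Filter.map (extChartAt (𝓡 2) x) (𝓝 x) = 𝓝 a :=
    map_extChartAt_nhds_of_boundaryless x
  have hmaps : Filter.map (extChartAt (𝓡 2) (ψ.toFun x)).symm (𝓝 b) = 𝓝 (ψ.toFun x) := by
    have := map_extChartAt_symm_nhdsWithin_range (I := 𝓡 2) (ψ.toFun x)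
    rwa [ModelWithCorners.range_eq_univ, nhdsWithin_univ] at this
  have hmap : Filter.map ψ.toFun (𝓝 x) = 𝓝 (ψ.toFun x) := by
    rw [← hmaps, ← hmapf, ← hmapx, Filter.map_map, Filter.map_map]
    apply Filter.map_congr
    filter_upwards [hfx, hsource'] with y h1 h2
    simp only [Function.comp_apply, h1, (extChartAt (𝓡 2) (ψ.toFun x)).left_inv h2]
  refine ⟨hmap, fun g hg => ?_⟩
  have hloc : ContDiffAt ℝ ∞ (hcd.localInverse hder (by simp)) b := by
    rw [← hfa]; exact hcd.to_localInverse hder (by simp)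
  have hlb : hcd.localInverse hder (by simp) b = a := by
    rw [← hfa]; exact hcd.localInverse_apply_image hder (by simp)
  have hG : ContMDiffAt (𝓡 2) (𝓡 2) ∞ ((extChartAt (𝓡 2) x).symm ∘
      (hcd.localInverse hder (by simp)) ∘ (extChartAt (𝓡 2) (ψ.toFun x))) (ψ.toFun x) := by
    have h1 : ContMDiffAt (𝓡 2) 𝓘(ℝ, Plane) ∞ (extChartAt (𝓡 2) (ψ.toFun x)) (ψ.toFun x) :=
      contMDiffAt_extChartAt
    have h2 : ContMDiffAt 𝓘(ℝ, Plane) 𝓘(ℝ, Plane) ∞ (hcd.localInverse hder (by simp)) b :=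
      hloc.contMDiffAt
    have h3 : ContMDiffAt 𝓘(ℝ, Plane) (𝓡 2) ∞ (extChartAt (𝓡 2) x).symm a :=
      (contMDiffOn_extChartAt_symm x).contMDiffAt (extChartAt_target_mem_nhds x)
    exact (ContMDiffAt.comp_of_eq (h3) (ContMDiffAt.comp (ψ.toFun x) h2 h1) hlb)
  refine hG.congr_of_eventuallyEq ?_
  rw [← hmap]
  have hleft := hstrict.eventually_left_inverse
  rw [← hmapx] at hleft
  refine Filter.eventually_map.2 ?_
  filter_upwards [hfx, hsource, Filter.eventually_map.1 hleft] with y h1 h2 h3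
  rw [hg y]
  have h4 : hcd.localInverse hder (by simp) (f (extChartAt (𝓡 2) x y)) = extChartAt (𝓡 2) x y := h3
  simp only [Function.comp_apply, ← h1, h4, (extChartAt (𝓡 2) x).left_inv h2]

theorem SurfaceEmb.isOpenEmbedding {S T : OrientedSurface} (ψ : SurfaceEmb S T) :
    IsOpenEmbedding ψ.toFun :=
  ⟨ψ.isSmoothEmb.isEmbedding,
    (IsOpenMap.of_nhds_le fun x => (ψ.local_inverse x).1.ge).isOpen_range⟩

theorem SurfaceEmb.thicken_isOpenEmbedding {S T : OrientedSurface} (ψ : SurfaceEmb S T) :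
    IsOpenEmbedding ψ.thicken :=
  ψ.isOpenEmbedding.prodMap IsOpenEmbedding.id

/-- The map of knot spaces induced by an embedding of surfaces is continuous. -/
theorem Knot.continuous_map {S T : OrientedSurface} (ψ : SurfaceEmb S T) :
    Continuous (Knot.map ψ) := by
  refine continuous_generateFrom_iff.2 ?_
  rintro _ ⟨c, hc, C, hC, k, Ω, hΩ, rfl⟩
  rcases isEmpty_or_nonempty S with hS | hS
  · have : IsEmpty (Knot S) := ⟨fun K => hS.false (K.toFun 1).1⟩
    rw [Set.eq_empty_of_isEmpty (Knot.map ψ ⁻¹' _)]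
    exact isOpen_empty
  let h := ψ.thicken_isOpenEmbedding.toOpenPartialHomeomorph
  refine TopologicalSpace.isOpen_generateFrom_of_mem
    ⟨h.trans c, ?_, C, hC, k, Ω, hΩ, ?_⟩
  · rw [IsManifold.mem_maximalAtlas_iff_contMDiffOn] at hc ⊢
    have hh : ContMDiffOn thickModel thickModel ∞ h h.source :=
      ψ.isSmoothEmb_thicken.contMDiff.contMDiffOn
    have hh' : ContMDiffOn thickModel thickModel ∞ h.symm h.target := by
      have hl := Function.leftInverse_invFun ψ.isOpenEmbedding.injective
      set g := Function.invFun ψ.toFun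
      have hg : ContMDiffOn thickModel thickModel ∞ (Prod.map g (_root_.id : ℝ → ℝ)) h.target := by
        intro p hp
        have hp' : p ∈ Set.range ψ.thicken := by simpa [h] using hp
        obtain ⟨q, rfl⟩ := hp'
        exact (ContMDiffAt.prodMap ((ψ.local_inverse q.1).2 g hl)
          (contMDiffAt_id)).contMDiffWithinAt
      refine hg.congr ?_
      intro p hp
      have hp' : p ∈ Set.range ψ.thicken := by simpa [h] using hp
      obtain ⟨q, rfl⟩ := hp'
      rw [ψ.thicken_isOpenEmbedding.toOpenPartialHomeomorph_left_inv]
      exact Prod.ext (hl q.1).symm rfl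
    constructor
    · exact hc.1.comp (hh.mono fun y hy => hy.1) fun y hy => hy.2
    · exact hh'.comp (hc.2.mono fun y hy => hy.1) fun y hy => hy.2
  · ext K
    simp only [Knot.subbasic, Set.mem_preimage, Set.mem_ofPred_eq]
    refine forall₂_congr fun θ _ => and_congr ?_ Iff.rfl
    simp [h, Knot.map]

theorem Knot.exists_lift {S T : OrientedSurface} (ψ : SurfaceEmb S T) (K : Knot T)
    (h : ∀ z, (K.toFun z).1 ∈ Set.range ψ.toFun) : ∃ L : Knot S, L.map ψ = K := by
  choose x hx using h
  let F : Circle → S × ℝ := fun z => (x z, (K.toFun z).2)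
  have hF : ψ.thicken ∘ F = K.toFun := by
    funext z
    exact Prod.ext (hx z) rfl
  have : Nonempty S := ⟨x 1⟩
  have hl := Function.leftInverse_invFun ψ.isOpenEmbedding.injective
  set g := Function.invFun ψ.toFun
  have hF' : F = Prod.map g (_root_.id : ℝ → ℝ) ∘ K.toFun := by
    funext z
    refine Prod.ext ?_ rfl
    change x z = g (K.toFun z).1
    rw [← hx z, hl]
  have hsm : ContMDiff (𝓡 1) thickModel ∞ F := by
    intro z
    rw [hF']
    have h1 := (ψ.local_inverse (x z)).2 g hl
    rw [hx z] at h1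
    have h2 : ContMDiffAt thickModel thickModel ∞ (Prod.map g (_root_.id : ℝ → ℝ)) (K.toFun z) :=
      ContMDiffAt.prodMap' h1 contMDiffAt_id
    exact h2.comp z (K.isSmoothEmb.contMDiff z)
  refine ⟨⟨F, hsm, fun z => ?_, ?_⟩, Knot.ext hF⟩
  · have h1 := K.isSmoothEmb.immersion z
    rw [← hF, mfderiv_comp z (ψ.isSmoothEmb_thicken.contMDiff.mdifferentiable (by simp) _)
      (hsm.mdifferentiable (by simp) _)] at h1
    exact Function.Injective.of_comp h1
  · refine IsEmbedding.of_comp hsm.continuous ψ.isSmoothEmb_thicken.contMDiff.continuous ?_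
    rw [hF]
    exact K.isSmoothEmb.isEmbedding

/-- An embedding lifts through another one that contains its image. -/
theorem SurfaceEmb.exists_lift {S T R : OrientedSurface} (φ : SurfaceEmb S R)
    (υ : SurfaceEmb T R) (h : ∀ s, φ.toFun s ∈ Set.range υ.toFun) :
    ∃ ρ : SurfaceEmb S T, υ.toFun ∘ ρ.toFun = φ.toFun := by
  choose ρ hρ using h
  have hρ' : υ.toFun ∘ ρ = φ.toFun := funext hρ
  have hsm : ContMDiff (𝓡 2) (𝓡 2) ∞ ρ := by
    intro s
    have : Nonempty T := ⟨ρ s⟩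
    have hl := Function.leftInverse_invFun υ.isOpenEmbedding.injective
    set g := Function.invFun υ.toFun
    have hF' : ρ = g ∘ φ.toFun := by
      funext z
      simp only [Function.comp_apply]
      rw [← hρ z, hl]
    rw [hF']
    have h1 := (υ.local_inverse (ρ s)).2 g hl
    rw [hρ s] at h1
    exact h1.comp s (φ.isSmoothEmb.contMDiff s)
  refine ⟨⟨ρ, ⟨hsm, fun z => ?_, ?_⟩, fun z => ?_⟩, hρ'⟩
  · have h1 := φ.isSmoothEmb.immersion z
    rw [← hρ', mfderiv_comp z (υ.isSmoothEmb.contMDiff.mdifferentiable (by simp) _)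
      (hsm.mdifferentiable (by simp) _)] at h1
    exact Function.Injective.of_comp h1
  · refine IsEmbedding.of_comp hsm.continuous υ.isSmoothEmb.contMDiff.continuous ?_
    rw [hρ']
    exact φ.isSmoothEmb.isEmbedding
  · have h1 := φ.orientationPreserving z
    have h2 := υ.orientationPreserving (ρ z)
    have h3 := det_mfderiv_comp υ.toFun ρ υ.isSmoothEmb.contMDiff hsm z
    rw [hρ'] at h3
    rw [h3] at h1
    exact (pos_iff_pos_of_mul_pos h1).1 h2

/-- An open subset of an oriented surface is an oriented surface. -/
def OrientedSurface.restrict (S : OrientedSurface) (W : TopologicalSpace.Opens S) :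
    OrientedSurface where
  carrier := W
  oriented := by
    rintro e ⟨_, ⟨x, rfl⟩, he⟩ e' ⟨_, ⟨x', rfl⟩, he'⟩ y hy
    rw [Set.mem_singleton_iff] at he he'
    subst he he'
    have hq := OpenPartialHomeomorph.subtypeRestr_symm_trans_subtypeRestr (s := W) ⟨x⟩
      (chartAt Plane x.1) (chartAt Plane x'.1)
    have hev := hq.2.eventuallyEq_of_mem ((OpenPartialHomeomorph.open_source _).mem_nhds hy)
    rw [hev.fderiv_eq]
    rw [hq.1, OpenPartialHomeomorph.restr_source] at hy
    exact S.oriented _ (chart_mem_atlas _ _) _ (chart_mem_atlas _ _) y hy.1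

theorem mfderiv_val (S : OrientedSurface) (W : TopologicalSpace.Opens S) (x : W) :
    (mfderiv (𝓡 2) (𝓡 2) (Subtype.val : W → S) x : Plane →L[ℝ] Plane) =
      ContinuousLinearMap.id ℝ Plane := by
  have hc : ContinuousAt (Subtype.val : W → S) x := continuous_subtype_val.continuousAt
  refine HasMFDerivAt.mfderiv ⟨hc, ?_⟩
  have h1 : ∀ᶠ z in 𝓝 (extChartAt (𝓡 2) x x), z ∈ (extChartAt (𝓡 2) x.1).target :=
    extChartAt_target_mem_nhds x.1
  have h2 : ∀ᶠ z in 𝓝 (extChartAt (𝓡 2) x x), (extChartAt (𝓡 2) x.1).symm z =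
      Subtype.val ((extChartAt (𝓡 2) x).symm z) :=
    TopologicalSpace.Opens.chartAt_subtype_val_symm_eventuallyEq W (H := Plane) (x := x)
  have h3 : writtenInExtChartAt (𝓡 2) (𝓡 2) x (Subtype.val : W → S)
      =ᶠ[𝓝 (extChartAt (𝓡 2) x x)] (_root_.id : Plane → Plane) := by
    filter_upwards [h1, h2] with z hz1 hz2
    simp only [writtenInExtChartAt, Function.comp_apply, _root_.id]
    rw [← hz2]
    exact (extChartAt (𝓡 2) x.1).right_inv hz1
  have h4 : HasFDerivAt (writtenInExtChartAt (𝓡 2) (𝓡 2) x (Subtype.val : W → S))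
      (ContinuousLinearMap.id ℝ Plane) (extChartAt (𝓡 2) x x) :=
    (hasFDerivAt_id (𝕜 := ℝ) (E := Plane) (extChartAt (𝓡 2) x x)).congr_of_eventuallyEq h3
  exact h4.hasFDerivWithinAt

theorem mfderiv_restrict_val (S : OrientedSurface) (W : TopologicalSpace.Opens S)
    (x : S.restrict W) :
    (mfderiv (𝓡 2) (𝓡 2) (fun y : S.restrict W => (Subtype.val : W → S) y) x :
      Plane →L[ℝ] Plane) = ContinuousLinearMap.id ℝ Plane :=
  mfderiv_val S W x

/-- The inclusion of an open subset. -/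
def OrientedSurface.incl (S : OrientedSurface) (W : TopologicalSpace.Opens S) :
    SurfaceEmb (S.restrict W) S where
  toFun := fun y : S.restrict W => (Subtype.val : W → S) y
  isSmoothEmb :=
    { contMDiff := (contMDiff_subtype_val : ContMDiff (𝓡 2) (𝓡 2) ∞ (Subtype.val : W → S))
      immersion := fun x => by
        have h := mfderiv_restrict_val S W x
        intro v w hvw
        have h' : ∀ u : Plane, (mfderiv (𝓡 2) (𝓡 2)
            (fun y : S.restrict W => (Subtype.val : W → S) y) x : Plane →L[ℝ] Plane) u = u :=
          fun u => by rw [h]; rfl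
        exact (h' v).symm.trans (hvw.trans (h' w))
      isEmbedding := (IsEmbedding.subtypeVal : IsEmbedding (Subtype.val : W → S)) }
  orientationPreserving := fun x => by
    rw [mfderiv_restrict_val S W x]
    have : ContinuousLinearMap.det (ContinuousLinearMap.id ℝ Plane) = 1 := LinearMap.det_id
    exact this ▸ one_pos

theorem OrientedSurface.range_incl (S : OrientedSurface) (W : TopologicalSpace.Opens S) :
    Set.range (S.incl W).toFun = W :=
  Subtype.range_coe

/-! ## The virtual knot site -/

/-- Objects of the virtual knot category: open sets `U` of knot spaces of oriented surfaces. -/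
structure VK : Type 1 where
  surface : OrientedSurface
  knots : TopologicalSpace.Opens (Knot surface)

/-- Arrows of the virtual knot category: functions between the underlying sets of knots which are
induced by an orientation preserving embedding of the surfaces. Two arrows are equal as soon as
they agree as functions. -/
@[ext]
structure VK.Hom (U V : VK) : Type where
  toFun : U.knots → V.knots
  induced : ∃ ψ : SurfaceEmb U.surface V.surface, ∀ K, (toFun K).1 = K.1.map ψ

instance : Category.{0} VK where
  Hom := VK.Hom
  id U := ⟨_root_.id, SurfaceEmb.id _, fun _ => rfl⟩
  comp f g := ⟨g.toFun ∘ f.toFun, by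
    obtain ⟨φ, hφ⟩ := f.induced
    obtain ⟨ψ, hψ⟩ := g.induced
    exact ⟨ψ.comp φ, fun K => by rw [Knot.map_comp, ← hφ, ← hψ]; rfl⟩⟩

/-- The image of a knot under an arrow. -/
def VK.apply {U V : VK} (Ψ : U ⟶ V) (K : U.knots) : V.knots := VK.Hom.toFun Ψ K

theorem VK.square {U V O : VK} (Φ : V ⟶ U) (Υ : O ⟶ U) (K : V.knots) (L : O.knots)
    (h : VK.apply Φ K = VK.apply Υ L) :
    ∃ (W : VK) (f : W ⟶ V) (g : W ⟶ O) (M : W.knots),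
      f ≫ Φ = g ≫ Υ ∧ VK.apply f M = K := by
  obtain ⟨φ, hφ⟩ := VK.Hom.induced Φ
  obtain ⟨υ, hυ⟩ := VK.Hom.induced Υ
  -- the part of the surface of `V` lying over the image of the surface of `O`
  let P : TopologicalSpace.Opens V.surface :=
    ⟨φ.toFun ⁻¹' Set.range υ.toFun,
      υ.isOpenEmbedding.isOpen_range.preimage φ.isSmoothEmb.contMDiff.continuous⟩
  let ι := V.surface.incl P
  obtain ⟨ρ, hρ⟩ := SurfaceEmb.exists_lift (φ.comp ι) υ (fun s => (Subtype.property (p := (· ∈ P)) s))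
  have hcomm : ∀ M : Knot (V.surface.restrict P), (M.map ι).map φ = (M.map ρ).map υ := by
    intro M
    ext1
    funext z
    exact Prod.ext (congrFun hρ (M.toFun z).1).symm rfl
  have hK : (K.1.map φ) = L.1.map υ := by
    have := congrArg Subtype.val h
    exact (hφ K).symm.trans (this.trans (hυ L))
  obtain ⟨M, hM⟩ := Knot.exists_lift ι K.1 (by
    intro z
    rw [OrientedSurface.range_incl]
    exact ⟨(L.1.toFun z).1, (congrArg Prod.fst (congrFun (congrArg Knot.toFun hK) z)).symm⟩)
  have hM' : M.map ρ = L.1 := by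
    apply Knot.map_injective υ
    rw [← hcomm, hM, hK]
  let W : VK := ⟨V.surface.restrict P,
    ⟨Knot.map ι ⁻¹' V.knots ∩ Knot.map ρ ⁻¹' O.knots,
      (V.knots.2.preimage (Knot.continuous_map ι)).inter
        (O.knots.2.preimage (Knot.continuous_map ρ))⟩⟩
  let f : VK.Hom W V := ⟨fun N => ⟨N.1.map ι, N.2.1⟩, ι, fun _ => rfl⟩
  let g : VK.Hom W O := ⟨fun N => ⟨N.1.map ρ, N.2.2⟩, ρ, fun _ => rfl⟩
  refine ⟨W, f, g, ⟨M, ?_, ?_⟩, ?_, Subtype.ext hM⟩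
  · change M.map ι ∈ V.knots
    rw [hM]; exact K.2
  · change M.map ρ ∈ O.knots
    rw [hM']; exact L.2
  · apply VK.Hom.ext
    funext N
    apply Subtype.ext
    exact (hφ (f.toFun N)).trans ((hcomm N.1).trans (hυ (g.toFun N)).symm)

/-- The Grothendieck topology on the virtual knot category: a sieve on `U` is covering if `U` is
the union of the images of its arrows. -/
def VK.J : GrothendieckTopology VK where
  sieves U := {S | ∀ K : U.knots, ∃ (V : VK) (Ψ : V ⟶ U), S Ψ ∧ K ∈ Set.range (VK.apply Ψ)}
  top_mem' U K := ⟨U, 𝟙 U, trivial, K, rfl⟩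
  pullback_stable' := by
    intro U V S Φ hS K
    obtain ⟨O, Υ, hΥ, L, hL⟩ := hS (VK.apply Φ K)
    obtain ⟨W, f, g, M, hfg, hM⟩ := VK.square Φ Υ K L hL.symm
    refine ⟨W, f, ?_, M, hM⟩
    change S (f ≫ Φ)
    rw [hfg]
    exact S.downward_closed hΥ g
  transitive' := by
    intro U S hS R hR K
    obtain ⟨V, Ψ, hΨ, L, rfl⟩ := hS K
    obtain ⟨W, Φ, hΦ, M, rfl⟩ := hR hΨ L
    exact ⟨W, Φ ≫ Ψ, hΦ, M, rfl⟩

/-- The forgetful functor, sending `U` to its set of knots. -/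
def VK.forget : VK ⥤ Type where
  obj U := U.knots
  map Ψ := ↾(VK.apply Ψ)

/-- Variable-space knots: the connected components of the category of elements of the forgetful
functor. -/
abbrev VariableSpaceKnot : Type 1 := CategoryTheory.ConnectedComponents VK.forget.Elements

/-! ## Points of the virtual knot topos -/

/-- The virtual knot space: the topos of sheaves of sets on the virtual knot site. The category of
sets is taken large enough for the site to be small. -/
abbrev VKTopos := Sheaf VK.J (Type 1)

universe v₁ v₂ u₁ u₂

/-- A geometric morphism `ℰ → ℱ`: an adjunction `f^* ⊣ f_*` with `f^* : ℱ ⥤ ℰ` left exact. -/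
structure GeometricMorphism (ℰ : Type u₁) [Category.{v₁} ℰ] (ℱ : Type u₂) [Category.{v₂} ℱ] where
  inverseImage : ℱ ⥤ ℰ
  directImage : ℰ ⥤ ℱ
  adj : inverseImage ⊣ directImage
  leftExact : PreservesFiniteLimits inverseImage

/-- The category of geometric morphisms: an arrow `f ⟶ g` is a natural transformation
`f^* ⟶ g^*`. -/
instance (ℰ : Type u₁) [Category.{v₁} ℰ] (ℱ : Type u₂) [Category.{v₂} ℱ] :
    Category (GeometricMorphism ℰ ℱ) where
  Hom f g := f.inverseImage ⟶ g.inverseImage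
  id f := 𝟙 f.inverseImage
  comp α β := NatTrans.vcomp α β

/-- Virtual knots: geometric morphisms from sets to the virtual knot topos, up to isomorphism. -/
abbrev VirtualKnot := Quotient (isIsomorphicSetoid (GeometricMorphism (Type 1) VKTopos))

/-- The functor `U ↦ p^*(a(y U))` from the virtual knot category to sets attached to a point `p`
of the virtual knot topos, where `a(y U)` is the sheaf associated to the presheaf represented
by `U`. -/
def fiber (p : GeometricMorphism (Type 1) VKTopos) : VK ⥤ Type 1 :=
  uliftYoneda.{1} ⋙ presheafToSheaf VK.J (Type 1) ⋙ p.inverseImage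

/-- The element `u ∈ A(U)` determines the knot `K ∈ U`: the intersection of the images of all
arrows `Ψ : V ⟶ U` such that `u` is in the image of `A(Ψ)` is `{K}`. -/
def Determines (A : VK ⥤ Type 1) {U : VK} (u : A.obj U) (K : U.knots) : Prop :=
  {L : U.knots | ∀ (V : VK) (Ψ : V ⟶ U), (∃ v : A.obj V, A.map Ψ v = u) →
    L ∈ Set.range (VK.apply Ψ)} = {K}

end VirtualKnots

end

/-!
A point of the virtual knot topos is the same as a flat functor `A : VK ⥤ Type 1` that is continuous
for the topology, its values being the fibers `p^*(a(y U))`. One direction is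
`GeometricMorphism.toPoint`: a cocontinuous left exact functor on presheaves restricts to a functor
on representables whose category of elements is cofiltered. The other direction is Mathlib's
theory of points of a site, and `GeometricMorphism.nonempty_iso_of_fiber_iso` says that `p` can be
recovered from its fibers. It remains to classify these functors.

Let `u ∈ A(U)`. The open sets `O ⊆ U` for which `u` comes from `A(O)` form a completely prime filter:
covers give primeness, and cofilteredness gives intersections. The space of knots is Hausdorff,
because evaluation at an angle is continuous, so this filter consists of the neighbourhoods of a
single knot `K`, and `u` lifts along an arrow `Ψ` exactly if `K` is in the image of `Ψ`. In
particular `u` determines `K` (`exists_determines`). Determined knots are carried forward along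
arrows (`Determines.map`) and lift back along them (`Determines.exists_map_eq`); with
cofilteredness, the knots determined by elements of the fibers of `A` form exactly one component of
the category of elements (`Determines.mk_eq_mk`, `Determines.exists_of_mk_eq_mk`).

Every component arises, since a knot `K ∈ U` has a point `knotPoint K` whose fibers are germs of
arrows at `K`; the cofiltered category behind these germs is the slice of the category of elements
over `(U, K)`, which is a preorder as all arrows are monic. Two points `A` and `B` with the same
component have isomorphic fibers: if `u ∈ A(U)` and `w ∈ B(U)` determine the same knot, then `u`
and `w` lift along the same arrows, uniquely, and every element of a fiber of `A` is reached from
such a lift of `u`, so matching the lifts of `u` with those of `w` matches the fibers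
(`Determines.nonempty_iso`).
-/

noncomputable section

namespace VirtualKnots

/-! ### Points of a site from geometric morphisms -/

section Generic

universe v u

variable {C : Type max u v} [Category.{v} C]

/-- A presheaf is a colimit of representables, so a cocontinuous functor to sets has every element
of a value in the image of its value at a representable. -/
theorem exists_uliftYoneda_map_eq (G : (Cᵒᵖ ⥤ Type max u v) ⥤ Type max u v)
    [PreservesColimitsOfSize.{v, max u v} G] {P : Cᵒᵖ ⥤ Type max u v} (x : G.obj P) :
    ∃ (U : C) (s : uliftYoneda.{max u v}.obj U ⟶ P) (y : G.obj (uliftYoneda.{max u v}.obj U)),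
      G.map s y = x := by
  obtain ⟨j, y, hy⟩ := Types.jointly_surjective_of_isColimit
    (isColimitOfPreserves G (Presheaf.colimitOfRepresentable.{max u v} P)) x
  exact ⟨_, _, y, hy⟩

/-- The restriction to representables of a cocontinuous and left exact functor on presheaves is
flat, in the form that its category of elements is cofiltered. -/
theorem isCofiltered_elements_uliftYoneda_comp (G : (Cᵒᵖ ⥤ Type max u v) ⥤ Type max u v)
    [PreservesColimitsOfSize.{v, max u v} G] [PreservesFiniteLimits G] :
    IsCofiltered (uliftYoneda.{max u v} ⋙ G).Elements where
  cone_objs := by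
    rintro ⟨U, x⟩ ⟨V, y⟩
    have ht : IsTerminal (G.obj (⊤_ _)) := IsTerminal.isTerminalObj G _ terminalIsTerminal
    obtain ⟨z, hz₁, hz₂⟩ := Types.exists_of_isPullback
      ((IsPullback.of_hasBinaryProduct' (uliftYoneda.{max u v}.obj U)
        (uliftYoneda.{max u v}.obj V)).map G)
      x y (((Types.isTerminalEquivUnique _ ht).instSubsingleton).elim _ _)
    obtain ⟨W, s, w, rfl⟩ := exists_uliftYoneda_map_eq G z
    obtain ⟨f, hf⟩ := uliftYoneda.{max u v}.map_surjective (s ≫ prod.fst)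
    obtain ⟨g, hg⟩ := uliftYoneda.{max u v}.map_surjective (s ≫ prod.snd)
    refine ⟨⟨W, w⟩, ⟨f, ?_⟩, ⟨g, ?_⟩, trivial⟩
    · change G.map (uliftYoneda.{max u v}.map f) w = x
      rw [hf, ← hz₁]; simp
    · change G.map (uliftYoneda.{max u v}.map g) w = y
      rw [hg, ← hz₂]; simp
  cone_maps := by
    rintro ⟨U, x⟩ ⟨V, y⟩ ⟨f, hf⟩ ⟨g, hg⟩
    have hl := isLimitForkMapOfIsLimit G _
      (equalizerIsEqualizer (uliftYoneda.{max u v}.map f) (uliftYoneda.{max u v}.map g))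
    obtain ⟨l, hl⟩ := Fork.IsLimit.lift' hl (W := PUnit.{max u v + 1}) (↾fun _ => x) (by
      ext
      exact hf.trans hg.symm)
    obtain ⟨W, s, w, hw⟩ := exists_uliftYoneda_map_eq G (l PUnit.unit)
    obtain ⟨h, hh⟩ := uliftYoneda.{max u v}.map_surjective (s ≫ equalizer.ι _ _)
    refine ⟨⟨W, w⟩, ⟨h, ?_⟩, ?_⟩
    · change G.map (uliftYoneda.{max u v}.map h) w = x
      rw [hh, G.map_comp]
      have := ConcreteCategory.congr_hom hl PUnit.unit
      simpa [hw] using this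
    · apply Subtype.ext
      apply uliftYoneda.{max u v}.map_injective
      change uliftYoneda.{max u v}.map (h ≫ f) = uliftYoneda.{max u v}.map (h ≫ g)
      rw [Functor.map_comp, Functor.map_comp, hh, Category.assoc, equalizer.condition,
        Category.assoc]
  nonempty := by
    have ht : IsTerminal (G.obj (⊤_ _)) := IsTerminal.isTerminalObj G _ terminalIsTerminal
    obtain ⟨U, -, y, -⟩ := exists_uliftYoneda_map_eq G (Types.isTerminalEquivUnique _ ht).default
    exact ⟨⟨U, y⟩⟩

variable {J : GrothendieckTopology C} [HasSheafify J (Type max u v)]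

/-- The inclusion of a covering sieve into a representable becomes an isomorphism after
sheafification, hence a covering sieve is jointly surjective on the fiber of a point. -/
theorem exists_map_eq_of_mem (p : GeometricMorphism (Type max u v) (Sheaf J (Type max u v)))
    {U : C} (R : Sieve U) (hR : R ∈ J U)
    (x : (uliftYoneda.{max u v} ⋙ presheafToSheaf J _ ⋙ p.inverseImage).obj U) :
    ∃ (V : C) (f : V ⟶ U) (_ : R f)
      (y : (uliftYoneda.{max u v} ⋙ presheafToSheaf J _ ⋙ p.inverseImage).obj V),
      (uliftYoneda.{max u v} ⋙ presheafToSheaf J _ ⋙ p.inverseImage).map f y = x := by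
  have := p.adj.leftAdjoint_preservesColimits
  let G := presheafToSheaf J (Type max u v) ⋙ p.inverseImage
  let i : Sieve.uliftFunctor.{max u v} R ⟶ uliftYoneda.{max u v}.obj U :=
    Sieve.uliftFunctorInclusion R
  have hi : J.W i := by
    have : Presheaf.IsLocallySurjective J i := ⟨fun {V} f => by
      refine J.superset_covering ?_ (J.pullback_stable f.down hR)
      intro W g hg
      exact ⟨⟨⟨g ≫ f.down, hg⟩⟩, rfl⟩⟩
    have : Presheaf.IsLocallyInjective J i :=
      Presheaf.isLocallyInjective_of_injective J i fun V x y h =>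
        ULift.ext _ _ (Subtype.ext (congrArg ULift.down h))
    exact J.W_of_isLocallyBijective i
  have hG : IsIso (G.map i) := by
    have := (J.W_iff i).1 hi
    dsimp [G]; infer_instance
  obtain ⟨z, rfl⟩ := ((isIso_iff_bijective _).1 hG).2 x
  obtain ⟨V, s, y, rfl⟩ := exists_uliftYoneda_map_eq G z
  obtain ⟨f, hf⟩ := uliftYoneda.{max u v}.map_surjective (s ≫ i)
  refine ⟨V, f, ?_, y, ?_⟩
  · have h := ConcreteCategory.congr_hom (congr_app hf (op V)) ⟨𝟙 V⟩
    have h' : 𝟙 V ≫ f = (s.app (op V) ⟨𝟙 V⟩).down.1 := congrArg ULift.down h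
    rw [Category.id_comp] at h'
    rw [h']
    exact (s.app (op V) ⟨𝟙 V⟩).down.2
  · change G.map (uliftYoneda.{max u v}.map f) y = _
    rw [hf]; simp

/-- The point of a site underlying a geometric morphism from sets. -/
def GeometricMorphism.toPoint
    (p : GeometricMorphism (Type max u v) (Sheaf J (Type max u v))) :
    GrothendieckTopology.Point.{max u v} J where
  fiber := uliftYoneda.{max u v} ⋙ presheafToSheaf J _ ⋙ p.inverseImage
  isCofiltered := by
    have := p.adj.leftAdjoint_preservesColimits
    have := p.leftExact
    exact isCofiltered_elements_uliftYoneda_comp (presheafToSheaf J _ ⋙ p.inverseImage)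
  initiallySmall := by
    have : EssentiallySmall.{max u v}
        (uliftYoneda.{max u v} ⋙ presheafToSheaf J _ ⋙ p.inverseImage).Elements :=
      essentiallySmall_of_small_of_locallySmall _
    exact initiallySmall_of_essentiallySmall _
  jointly_surjective R hR x := exists_map_eq_of_mem p R hR x

/-- The geometric morphism from sets attached to a point of a site. -/
def GeometricMorphism.ofPoint [LocallySmall.{max u v} C]
    (Φ : GrothendieckTopology.Point.{max u v} J) :
    GeometricMorphism (Type max u v) (Sheaf J (Type max u v)) where
  inverseImage := Φ.sheafFiber
  directImage := Φ.skyscraperSheafFunctor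
  adj := Φ.skyscraperSheafAdjunction
  leftExact := inferInstance

/-- The fiber functor of the geometric morphism attached to a point is that of the point. -/
def GeometricMorphism.toPointOfPointIso [LocallySmall.{max u v} C]
    (Φ : GrothendieckTopology.Point.{max u v} J) :
    (GeometricMorphism.ofPoint Φ).toPoint.fiber ≅ Φ.fiber :=
  Functor.isoWhiskerLeft uliftYoneda.{max u v} (Φ.presheafToSheafCompSheafFiberIso _) ≪≫
    Functor.isoWhiskerRight (uliftYonedaIsoShrinkYoneda.{max u v}) _ ≪≫
    Φ.shrinkYonedaCompPresheafFiberIso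

/-- A geometric morphism from sets is determined by its fibers at the representables: the inverse
image of a presheaf's associated sheaf is the cocontinuous extension of these fibers. -/
theorem GeometricMorphism.nonempty_iso_of_fiber_iso
    (p q : GeometricMorphism (Type max u v) (Sheaf J (Type max u v)))
    (e : uliftYoneda.{max u v} ⋙ presheafToSheaf J _ ⋙ p.inverseImage ≅
      uliftYoneda.{max u v} ⋙ presheafToSheaf J _ ⋙ q.inverseImage) :
    Nonempty (p ≅ q) := by
  have := p.adj.leftAdjoint_preservesColimits
  have := q.adj.leftAdjoint_preservesColimits
  let e₁ : presheafToSheaf J (Type max u v) ⋙ p.inverseImage ≅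
      presheafToSheaf J (Type max u v) ⋙ q.inverseImage :=
    Presheaf.uniqueExtensionAlongULiftYoneda.{max u v} _ (Iso.refl _) ≪≫
      (Presheaf.uniqueExtensionAlongULiftYoneda.{max u v} _ e).symm
  let e₂ (r : GeometricMorphism (Type max u v) (Sheaf J (Type max u v))) :
      sheafToPresheaf J (Type max u v) ⋙ presheafToSheaf J (Type max u v) ⋙ r.inverseImage ≅
        r.inverseImage :=
    (Functor.associator _ _ _).symm ≪≫
      Functor.isoWhiskerRight (asIso (sheafificationAdjunction J (Type max u v)).counit)
        r.inverseImage ≪≫ r.inverseImage.leftUnitor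
  let e₃ : p.inverseImage ≅ q.inverseImage :=
    (e₂ p).symm ≪≫ Functor.isoWhiskerLeft (sheafToPresheaf J (Type max u v)) e₁ ≪≫ e₂ q
  exact ⟨⟨e₃.hom, e₃.inv, e₃.hom_inv_id, e₃.inv_hom_id⟩⟩

end Generic

/-! ### The space of knots is Hausdorff -/

theorem Knot.continuous_eval (S : OrientedSurface) (z : Circle) :
    Continuous fun K : Knot S => K.toFun z := by
  obtain ⟨θ, rfl⟩ : ∃ θ, Circle.exp θ = z := ⟨_, Circle.exp_arg z⟩
  refine continuous_def.2 fun O hO => isOpen_iff_mem_nhds.2 fun K hK => ?_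
  -- the constraint at the single angle `θ`, on the value alone, in a chart restricted to `O`
  let c := (chartAt (ModelProd Plane ℝ) (K.toFun (Circle.exp θ))).restr O
  have hc : c ∈ IsManifold.maximalAtlas thickModel ∞ (S × ℝ) :=
    restr_mem_maximalAtlas _ (IsManifold.chart_mem_maximalAtlas _) hO
  have hsource : c.source = (chartAt (ModelProd Plane ℝ) (K.toFun (Circle.exp θ))).source ∩ O := by
    rw [OpenPartialHomeomorph.restr_source, hO.interior_eq]
  have hopen : IsOpen (Knot.subbasic c {θ} 0 Set.univ) :=
    TopologicalSpace.isOpen_generateFrom_of_mem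
      ⟨c, hc, {θ}, isCompact_singleton, 0, Set.univ, isOpen_univ, rfl⟩
  refine Filter.mem_of_superset (hopen.mem_nhds ?_) ?_
  · rintro _ rfl
    exact ⟨hsource ▸ ⟨mem_chart_source _ _, hK⟩, trivial⟩
  · intro L hL
    have h := (hL θ rfl).1
    rw [hsource] at h
    exact h.2

instance (S : OrientedSurface) : T2Space (Knot S) :=
  T2Space.of_injective_continuous (f := fun (K : Knot S) z => K.toFun z)
    (fun _ _ h => Knot.ext h) (continuous_pi (Knot.continuous_eval S))

/-! ### Arrows of the virtual knot category -/

theorem VK.apply_injective {U V : VK} (Ψ : U ⟶ V) : Function.Injective (VK.apply Ψ) := by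
  obtain ⟨ψ, hψ⟩ := VK.Hom.induced Ψ
  intro K L h
  apply Subtype.ext
  apply Knot.map_injective ψ
  rw [← hψ, ← hψ]
  exact congrArg Subtype.val h

theorem VK.hom_ext {U V : VK} {Ψ Φ : U ⟶ V} (h : ∀ K, VK.apply Ψ K = VK.apply Φ K) : Ψ = Φ :=
  VK.Hom.ext (funext h)

@[simp]
theorem VK.apply_comp {U V W : VK} (Ψ : U ⟶ V) (Φ : V ⟶ W) (K : U.knots) :
    VK.apply (Ψ ≫ Φ) K = VK.apply Φ (VK.apply Ψ K) := rfl

instance {U V : VK} (Ψ : U ⟶ V) : Mono Ψ where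
  right_cancellation _ _ h := VK.hom_ext fun K =>
    VK.apply_injective Ψ (congrArg (fun k => VK.apply k K) h)

theorem VK.continuous_apply {U V : VK} (Ψ : U ⟶ V) : Continuous (VK.apply Ψ) := by
  obtain ⟨ψ, hψ⟩ := VK.Hom.induced Ψ
  refine continuous_induced_rng.2 ?_
  have h : Subtype.val ∘ VK.apply Ψ = fun K => Knot.map ψ K.1 := funext hψ
  rw [h]
  exact (Knot.continuous_map ψ).comp continuous_subtype_val

/-- The object of knots of `U` that lie in an open subset of `U`. -/
def VK.restrict (U : VK) (O : TopologicalSpace.Opens U.knots) : VK where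
  surface := U.surface
  knots := ⟨Subtype.val '' (O : Set U.knots), U.knots.2.isOpenEmbedding_subtypeVal.isOpenMap _ O.2⟩

/-- The inclusion of an open subset. -/
def VK.ι (U : VK) (O : TopologicalSpace.Opens U.knots) : U.restrict O ⟶ U :=
  (⟨fun K => ⟨K.1, by obtain ⟨L, -, hL⟩ := K.2; exact hL ▸ L.2⟩, SurfaceEmb.id _, fun _ => rfl⟩ :
    VK.Hom (U.restrict O) U)

theorem VK.range_ι (U : VK) (O : TopologicalSpace.Opens U.knots) :
    Set.range (VK.apply (U.ι O)) = O := by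
  ext K
  constructor
  · rintro ⟨⟨_, L, hL, rfl⟩, rfl⟩
    exact hL
  · intro hK
    exact ⟨⟨K.1, K, hK, rfl⟩, rfl⟩

theorem VK.exists_comp_ι {U V : VK} (Ψ : V ⟶ U) (O : TopologicalSpace.Opens U.knots)
    (h : ∀ K, VK.apply Ψ K ∈ O) : ∃ Φ : V ⟶ U.restrict O, Φ ≫ U.ι O = Ψ := by
  obtain ⟨ψ, hψ⟩ := VK.Hom.induced Ψ
  exact ⟨(⟨fun K => ⟨(VK.apply Ψ K).1, _, h K, rfl⟩, ψ, hψ⟩ : VK.Hom V (U.restrict O)), rfl⟩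

/-- The complement of a knot in an open set of knots. -/
def VK.compl {U : VK} (K : U.knots) : TopologicalSpace.Opens U.knots :=
  ⟨{K}ᶜ, isOpen_compl_singleton⟩

/-! ### The knot determined by an element of the fiber of a point -/

section Point

variable (A : GrothendieckTopology.Point.{1} VK.J)

/-- The element `u` of the fiber of a point lifts along the arrow `Ψ`. -/
def LiftsAlong {U V : VK} (u : A.fiber.obj U) (Ψ : V ⟶ U) : Prop := ∃ v, A.fiber.map Ψ v = u

variable {A}

theorem LiftsAlong.of_comp {U V W : VK} {u : A.fiber.obj U} {Φ : W ⟶ V} {Ψ : V ⟶ U}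
    (h : LiftsAlong A u (Φ ≫ Ψ)) : LiftsAlong A u Ψ := by
  obtain ⟨w, rfl⟩ := h
  exact ⟨A.fiber.map Φ w, by simp⟩

theorem LiftsAlong.map {U V W : VK} {u : A.fiber.obj U} {Ψ : V ⟶ U} (h : LiftsAlong A u Ψ)
    (Φ : U ⟶ W) : LiftsAlong A (A.fiber.map Φ u) (Ψ ≫ Φ) := by
  obtain ⟨v, rfl⟩ := h
  exact ⟨v, by simp⟩

theorem LiftsAlong.of_comp_ι {U V : VK} {u : A.fiber.obj U} {Ψ : V ⟶ U}
    {O : TopologicalSpace.Opens U.knots} (h : LiftsAlong A u Ψ) (hO : ∀ K, VK.apply Ψ K ∈ O) :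
    LiftsAlong A u (U.ι O) := by
  obtain ⟨Φ, rfl⟩ := VK.exists_comp_ι Ψ O hO
  exact h.of_comp

/-- The fiber at an object without knots is empty, since the empty sieve covers it. -/
theorem nonempty_knots {U : VK} (u : A.fiber.obj U) : Nonempty U.knots := by
  by_contra hU
  obtain ⟨V, Ψ, h, -⟩ := A.jointly_surjective (⊥ : Sieve U) (fun K => (hU ⟨K⟩).elim) u
  exact h

theorem exists_map_eq_map {V W : VK} (v : A.fiber.obj V) (w : A.fiber.obj W) :
    ∃ (X : VK) (f : X ⟶ V) (g : X ⟶ W) (x : A.fiber.obj X),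
      A.fiber.map f x = v ∧ A.fiber.map g x = w := by
  obtain ⟨⟨X, x⟩, f, g, -⟩ := IsCofilteredOrEmpty.cone_objs
    (A.fiber.elementsMk V v) (A.fiber.elementsMk W w)
  exact ⟨X, f.1, g.1, x, f.2, g.2⟩

theorem exists_comp_eq_comp {U V W : VK} {v : A.fiber.obj V} {w : A.fiber.obj W} {f : V ⟶ U}
    {g : W ⟶ U} (h : A.fiber.map f v = A.fiber.map g w) :
    ∃ (X : VK) (f' : X ⟶ V) (g' : X ⟶ W) (x : A.fiber.obj X),
      f' ≫ f = g' ≫ g ∧ A.fiber.map f' x = v ∧ A.fiber.map g' x = w := by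
  let F : A.fiber.elementsMk V v ⟶ A.fiber.elementsMk U (A.fiber.map f v) := ⟨f, rfl⟩
  let G : A.fiber.elementsMk W w ⟶ A.fiber.elementsMk U (A.fiber.map f v) := ⟨g, h.symm⟩
  obtain ⟨⟨X, x⟩, f', g', hfg⟩ := IsCofiltered.cospan F G
  exact ⟨X, f'.1, g'.1, x, congrArg Subtype.val hfg, f'.2, g'.2⟩

/-- Two arrows along which an element lifts have intersecting images. -/
theorem LiftsAlong.exists_apply_eq {U V W : VK} {u : A.fiber.obj U} {Ψ : V ⟶ U} {Φ : W ⟶ U}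
    (hΨ : LiftsAlong A u Ψ) (hΦ : LiftsAlong A u Φ) :
    ∃ K L, VK.apply Ψ K = VK.apply Φ L := by
  obtain ⟨v, rfl⟩ := hΨ
  obtain ⟨w, hw⟩ := hΦ
  obtain ⟨X, f, g, x, hfg, -, -⟩ := exists_comp_eq_comp hw.symm
  obtain ⟨K⟩ := nonempty_knots x
  exact ⟨VK.apply f K, VK.apply g K, congrArg (fun k => VK.apply k K) hfg⟩

/-- An element of a fiber is concentrated near some knot: otherwise the open sets along which it
does not lift would cover. -/
theorem exists_forall_liftsAlong_ι {U : VK} (u : A.fiber.obj U) :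
    ∃ K : U.knots, ∀ O : TopologicalSpace.Opens U.knots, K ∈ O → LiftsAlong A u (U.ι O) := by
  by_contra! hK
  choose O hKO hO using hK
  let R : Sieve U :=
    { arrows := fun V Ψ => ∃ K, ∀ L, VK.apply Ψ L ∈ O K
      downward_closed := fun ⟨K, h⟩ _ => ⟨K, fun _ => h _⟩ }
  obtain ⟨V, Ψ, ⟨K, h⟩, hu⟩ := A.jointly_surjective R (fun K => by
    refine ⟨_, U.ι (O K), ⟨K, fun L => ?_⟩, ?_⟩
    · exact (VK.range_ι U (O K)).subset ⟨L, rfl⟩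
    · rw [VK.range_ι]
      exact hKO K) u
  exact hO K (LiftsAlong.of_comp_ι hu h)

/-- The arrow `Ψ` and the complement of one knot of its image cover `U`. -/
theorem liftsAlong_or_liftsAlong_compl {U V : VK} (u : A.fiber.obj U) (Ψ : V ⟶ U) (K : V.knots) :
    LiftsAlong A u Ψ ∨ LiftsAlong A u (U.ι (VK.compl (VK.apply Ψ K))) := by
  let R : Sieve U :=
    { arrows := fun W Φ => (∃ f, f ≫ Ψ = Φ) ∨ ∀ L, VK.apply Φ L ∈ VK.compl (VK.apply Ψ K)
      downward_closed := by
        rintro W X Φ (⟨f, rfl⟩ | h) g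
        · exact Or.inl ⟨g ≫ f, Category.assoc _ _ _⟩
        · exact Or.inr fun _ => h _ }
  obtain ⟨W, Φ, h, hu⟩ := A.jointly_surjective R (fun L => by
    by_cases hL : L = VK.apply Ψ K
    · exact ⟨V, Ψ, Or.inl ⟨𝟙 _, Category.id_comp _⟩, K, hL.symm⟩
    · refine ⟨_, U.ι (VK.compl (VK.apply Ψ K)), Or.inr fun M => ?_, ?_⟩
      · exact (VK.range_ι U _).subset ⟨M, rfl⟩
      · rw [VK.range_ι]
        exact hL) u
  rcases h with ⟨f, rfl⟩ | h
  · exact Or.inl (LiftsAlong.of_comp hu)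
  · exact Or.inr (LiftsAlong.of_comp_ι hu h)

/-- An element determines a knot as soon as the knot lies in the image of every arrow along which
the element lifts. -/
theorem determines_of_forall {U : VK} {u : A.fiber.obj U} {K : U.knots}
    (h : ∀ (V : VK) (Ψ : V ⟶ U), LiftsAlong A u Ψ → K ∈ Set.range (VK.apply Ψ)) :
    Determines A.fiber u K := by
  refine Set.Subset.antisymm (fun L hL => ?_) (Set.singleton_subset_iff.2 h)
  by_contra hne
  have hK : VK.apply (𝟙 U) K ∈ VK.compl L := fun e => hne e.symm
  -- the complement of `L` is an open neighbourhood of `K`, so the element lifts to it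
  rcases liftsAlong_or_liftsAlong_compl u (U.ι (VK.compl L))
    ((VK.range_ι U (VK.compl L)).superset hK).choose with hu | hu
  · have := hL _ _ hu
    rw [VK.range_ι] at this
    exact this rfl
  · have := h _ _ hu
    rw [VK.range_ι] at this
    exact this ((VK.range_ι U (VK.compl L)).superset hK).choose_spec.symm

theorem Determines.mem_range {U V : VK} {u : A.fiber.obj U} {K : U.knots}
    (hK : Determines A.fiber u K) {Ψ : V ⟶ U} (h : LiftsAlong A u Ψ) :
    K ∈ Set.range (VK.apply Ψ) :=
  hK.superset rfl V Ψ h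

theorem Determines.liftsAlong {U V : VK} {u : A.fiber.obj U} {Ψ : V ⟶ U} {L : V.knots}
    (hK : Determines A.fiber u (VK.apply Ψ L)) : LiftsAlong A u Ψ := by
  refine (liftsAlong_or_liftsAlong_compl u Ψ L).resolve_right fun hu => ?_
  have := hK.mem_range hu
  rw [VK.range_ι] at this
  exact this rfl

/-- Every element of a fiber determines a knot. -/
theorem exists_determines {U : VK} (u : A.fiber.obj U) : ∃ K, Determines A.fiber u K := by
  obtain ⟨K, hK⟩ := exists_forall_liftsAlong_ι u
  refine ⟨K, determines_of_forall fun V Ψ ⟨v, hv⟩ => ?_⟩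
  obtain ⟨L, hL⟩ := exists_forall_liftsAlong_ι v
  refine ⟨L, ?_⟩
  by_contra hne
  -- disjoint neighbourhoods of `Ψ L` and `K` along both of which `u` lifts
  obtain ⟨O, P, hO, hP, hLO, hKP, hd⟩ := t2_separation hne
  let O' : TopologicalSpace.Opens V.knots := ⟨VK.apply Ψ ⁻¹' O, hO.preimage (VK.continuous_apply Ψ)⟩
  obtain ⟨M, N, hMN⟩ := ((hL O' hLO).map Ψ).exists_apply_eq (hv ▸ hK ⟨P, hP⟩ hKP)
  have h₁ : VK.apply (V.ι O' ≫ Ψ) M ∈ O := (VK.range_ι V O').subset ⟨M, rfl⟩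
  have h₂ : VK.apply (V.ι O' ≫ Ψ) M ∈ P := hMN ▸ (VK.range_ι U ⟨P, hP⟩).subset ⟨N, rfl⟩
  exact Set.disjoint_left.1 hd h₁ h₂

theorem Determines.eq {U : VK} {u : A.fiber.obj U} {K L : U.knots}
    (hK : Determines A.fiber u K) (hL : Determines A.fiber u L) : K = L :=
  Set.singleton_injective (hK.symm.trans hL)

theorem Determines.map {U V : VK} {u : A.fiber.obj U} {K : U.knots}
    (hK : Determines A.fiber u K) (Ψ : U ⟶ V) :
    Determines A.fiber (A.fiber.map Ψ u) (VK.apply Ψ K) := by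
  obtain ⟨M, hM⟩ := exists_determines (A.fiber.map Ψ u)
  obtain ⟨L, rfl⟩ := hM.mem_range ⟨u, rfl⟩
  suffices h : L = K from h ▸ hM
  by_contra hne
  -- otherwise `u` lifts to the complement of `L`, hence its image to that of `Ψ L`
  let O := VK.compl L
  obtain ⟨N, rfl⟩ := (VK.range_ι U O).superset (Ne.symm hne)
  obtain ⟨N', hN'⟩ := hM.mem_range (hK.liftsAlong.map Ψ)
  exact (VK.range_ι U O).subset ⟨N', rfl⟩ (VK.apply_injective Ψ hN')

theorem Determines.exists_map_eq {U V : VK} {Ψ : U ⟶ V} {v : A.fiber.obj V} {K : U.knots}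
    (hK : Determines A.fiber v (VK.apply Ψ K)) :
    ∃ u, A.fiber.map Ψ u = v ∧ Determines A.fiber u K := by
  obtain ⟨u, rfl⟩ := hK.liftsAlong
  obtain ⟨L, hL⟩ := exists_determines u
  obtain rfl := VK.apply_injective Ψ ((hL.map Ψ).eq hK)
  exact ⟨u, rfl, hL⟩

end Point

/-! ### Comparison of two points that determine a common knot -/

section Comparison

variable {A B : GrothendieckTopology.Point.{1} VK.J}

/-- The correspondence between the fibers of two points `A` and `B` with base elements `u` and `w`
at the object `U`: two elements correspond if they come, by the same arrow, from elements above
`u` and `w` along the same arrow. -/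
def Corresponds {U : VK} (u : A.fiber.obj U) (w : B.fiber.obj U) {X : VK} (a : A.fiber.obj X)
    (b : B.fiber.obj X) : Prop :=
  ∃ (V : VK) (f : V ⟶ U) (g : V ⟶ X) (v : A.fiber.obj V) (v' : B.fiber.obj V),
    A.fiber.map f v = u ∧ B.fiber.map f v' = w ∧ A.fiber.map g v = a ∧ B.fiber.map g v' = b

theorem Corresponds.symm {U : VK} {u : A.fiber.obj U} {w : B.fiber.obj U} {X : VK}
    {a : A.fiber.obj X} {b : B.fiber.obj X} (h : Corresponds u w a b) : Corresponds w u b a := by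
  obtain ⟨V, f, g, v, v', h₁, h₂, h₃, h₄⟩ := h
  exact ⟨V, f, g, v', v, h₂, h₁, h₄, h₃⟩

theorem Corresponds.map {U : VK} {u : A.fiber.obj U} {w : B.fiber.obj U} {X Y : VK}
    {a : A.fiber.obj X} {b : B.fiber.obj X} (h : Corresponds u w a b) (k : X ⟶ Y) :
    Corresponds u w (A.fiber.map k a) (B.fiber.map k b) := by
  obtain ⟨V, f, g, v, v', h₁, h₂, rfl, rfl⟩ := h
  exact ⟨V, f, g ≫ k, v, v', h₁, h₂, by simp, by simp⟩

/-- An arrow along which `u` lifts has the determined knot in its image, so `w` lifts along it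
too. -/
theorem Determines.exists_corresponds {U : VK} {u : A.fiber.obj U} {w : B.fiber.obj U}
    {K : U.knots} (hu : Determines A.fiber u K) (hw : Determines B.fiber w K) {X : VK}
    (a : A.fiber.obj X) : ∃ b, Corresponds u w a b := by
  obtain ⟨V, f, g, v, rfl, rfl⟩ := exists_map_eq_map u a
  obtain ⟨L, rfl⟩ := hu.mem_range ⟨v, rfl⟩
  obtain ⟨v', rfl⟩ := hw.liftsAlong
  exact ⟨_, V, f, g, v, v', rfl, rfl, rfl, rfl⟩

theorem Corresponds.unique {U : VK} {u : A.fiber.obj U} {w : B.fiber.obj U} {K : U.knots}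
    (hu : Determines A.fiber u K) (hw : Determines B.fiber w K) {X : VK} {a : A.fiber.obj X}
    {b b' : B.fiber.obj X} (h : Corresponds u w a b) (h' : Corresponds u w a b') : b = b' := by
  obtain ⟨V, f, g, v, x, hf, hx, rfl, rfl⟩ := h
  obtain ⟨V', f', g', v', x', hf', hx', hg, rfl⟩ := h'
  obtain ⟨W, k, k', y, hk, rfl, rfl⟩ := exists_comp_eq_comp hg.symm
  -- equalize the two arrows to `U`, along which `y` is mapped to `u`
  obtain ⟨Z, z, hz⟩ : ∃ (Z : VK) (j : Z ⟶ W), j ≫ k ≫ f = j ≫ k' ≫ f' ∧ LiftsAlong A y j := by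
    let Y := A.fiber.elementsMk W y
    let F : Y ⟶ A.fiber.elementsMk U u := ⟨k ≫ f, by simpa using hf⟩
    let F' : Y ⟶ A.fiber.elementsMk U u := ⟨k' ≫ f', by simpa using hf'⟩
    exact ⟨_, (IsCofiltered.eqHom F F').1, congrArg Subtype.val (IsCofiltered.eq_condition F F'),
      _, (IsCofiltered.eqHom F F').2⟩
  obtain ⟨hz, t, rfl⟩ := hz
  -- the knot of `w` lies in the image of the common refinement, so `w` lifts there as well
  have hK : LiftsAlong A u (z ≫ k ≫ f) := ⟨t, by simpa using hf⟩
  obtain ⟨L, rfl⟩ := hu.mem_range hK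
  obtain ⟨s, hs⟩ := hw.liftsAlong
  have hsx : B.fiber.map (z ≫ k) s = x := by
    apply B.fiber_map_injective_of_mono f
    rw [hx, ← hs]; simp
  have hsx' : B.fiber.map (z ≫ k') s = x' := by
    apply B.fiber_map_injective_of_mono f'
    rw [hx', ← hs, hz]; simp
  rw [← hsx, ← hsx']
  have := congrArg (fun j => B.fiber.map (z ≫ j) s) hk
  simpa using this

/-- Two points with elements that determine the same knot have isomorphic fibers. -/
theorem Determines.nonempty_iso {U : VK} {u : A.fiber.obj U} {w : B.fiber.obj U} {K : U.knots}
    (hu : Determines A.fiber u K) (hw : Determines B.fiber w K) : Nonempty (A.fiber ≅ B.fiber) := by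
  choose F hF using fun X : VK => hu.exists_corresponds hw (X := X)
  choose G hG using fun X : VK => hw.exists_corresponds hu (X := X)
  let e (X : VK) : A.fiber.obj X ≃ B.fiber.obj X :=
    { toFun := F X
      invFun := G X
      left_inv := fun a => (hG X (F X a)).unique hw hu (hF X a).symm
      right_inv := fun b => (hF X (G X b)).unique hu hw (hG X b).symm }
  exact ⟨NatIso.ofComponents (fun X => (e X).toIso) fun {X Y} k => by
    ext a
    exact (hF Y (A.fiber.map k a)).unique hu hw ((hF X a).map k)⟩

end Comparison

/-! ### The point of a knot -/

section OfKnot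

variable {U : VK} (K : U.knots)

instance {e e' : VK.forget.Elements} (f : e ⟶ e') : Mono f where
  right_cancellation _ _ h :=
    Subtype.ext ((cancel_mono f.1).1 (congrArg Subtype.val h))

/-- The objects over `(U, K)` in the category of elements of the forgetful functor. They play the
role of the neighbourhoods of `K`: an arrow `V ⟶ U` is a neighbourhood as soon as `K` is in its
image, which is not required to be open in `U`. -/
abbrev Nbhd : Type 1 := Over (VK.forget.elementsMk U K)

variable {K}

theorem Nbhd.apply_hom (N : Nbhd K) : VK.apply N.hom.1 N.left.2 = K := N.hom.2

/-- The neighbourhood of `K` given by an arrow to another neighbourhood and a knot over the base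
knot of that neighbourhood. -/
def Nbhd.mk (N : Nbhd K) {W : VK} (f : W ⟶ N.left.1) (L : W.knots)
    (h : VK.apply f L = N.left.2) : Nbhd K :=
  Over.mk ((⟨f, h⟩ : VK.forget.elementsMk W L ⟶ N.left) ≫ N.hom)

/-- The arrow from the neighbourhood `N.mk f L h` to `N` given by `f`. -/
def Nbhd.mkHom (N : Nbhd K) {W : VK} (f : W ⟶ N.left.1) (L : W.knots)
    (h : VK.apply f L = N.left.2) : N.mk f L h ⟶ N :=
  Over.homMk (⟨f, h⟩ : VK.forget.elementsMk W L ⟶ N.left) rfl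

variable (K)

instance : IsCofiltered (Nbhd K) where
  cone_objs N P := by
    obtain ⟨W, f, g, M, hfg, hM⟩ := VK.square N.hom.1 P.hom.1 N.left.2 P.left.2
      (N.apply_hom.trans P.apply_hom.symm)
    have hM' : VK.apply g M = P.left.2 := VK.apply_injective P.hom.1 (by
      rw [← VK.apply_comp, ← hfg, VK.apply_comp, hM, N.apply_hom, P.apply_hom])
    exact ⟨N.mk f M hM, N.mkHom f M hM,
      Over.homMk (⟨g, hM'⟩ : VK.forget.elementsMk W M ⟶ P.left) (Subtype.ext hfg.symm), trivial⟩
  cone_maps N P f g := ⟨N, 𝟙 N, by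
    congr 1
    exact Over.OverMorphism.ext ((cancel_mono P.hom).1 ((Over.w f).trans (Over.w g).symm))⟩
  nonempty := ⟨Over.mk (𝟙 _)⟩

instance : InitiallySmall.{1} (Nbhd K) := by
  have : EssentiallySmall.{1} (Nbhd K) := essentiallySmallSelf.{1} (Nbhd K)
  exact initiallySmall_of_essentiallySmall.{1} (Nbhd K)

/-- The domain of a neighbourhood of `K`. -/
abbrev Nbhd.domain : Nbhd K ⥤ VK := Over.forget _ ⋙ CategoryOfElements.π _

/-- The point of the virtual knot site at a knot `K`: its fiber at `X` is the set of germs at `K`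
of arrows to `X`. -/
def knotPoint : GrothendieckTopology.Point.{1} VK.J :=
  GrothendieckTopology.Point.ofIsCofiltered.{1} (Nbhd.domain K) (by
    intro X R hR N f
    obtain ⟨Y, g, hg, L, hL⟩ := hR (VK.apply f N.left.2)
    obtain ⟨W, a, b, M, hab, hM⟩ := VK.square f g N.left.2 L hL.symm
    exact ⟨Y, g, hg, N.mk a M hM, N.mkHom a M hM, b, hab.symm⟩)

open GrothendieckTopology.Point.ofIsCofiltered in
/-- The germ of the identity at `K` determines `K`. -/
theorem exists_determines_knotPoint : ∃ u : (knotPoint K).fiber.obj U,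
    Determines (knotPoint K).fiber u K := by
  let I : Nbhd K := Over.mk (𝟙 _)
  refine ⟨fiberMk.{1} (p := Nbhd.domain K) (U := I) (𝟙 U), determines_of_forall ?_⟩
  rintro V Ψ ⟨v, hv⟩
  obtain ⟨N, f, rfl⟩ := fiberMk_jointly_surjective.{1} v
  change (GrothendieckTopology.Point.ofIsCofiltered.fiber.{1} (Nbhd.domain K)).map Ψ
    (fiberMk.{1} f) = _ at hv
  have hN : fiberMk.{1} (p := Nbhd.domain K) (U := I) (𝟙 U) =
      fiberMk.{1} (p := Nbhd.domain K) (U := N) N.hom.1 := by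
    have hI := fiberMk_map_comp.{1} (Nbhd.domain K) (Over.homMk N.hom : N ⟶ I) (𝟙 U)
    rw [← hI]
    congr 1
  rw [fiber_map_fiberMk, hN] at hv
  obtain ⟨P, h, hP⟩ := exists_of_fiberMk_eq_fiberMk.{1} hv
  refine ⟨VK.apply f (VK.apply h.left.1 P.left.2), ?_⟩
  have := congrArg (fun k => VK.apply k P.left.2) hP
  refine this.trans ?_
  have hw : VK.apply h.left.1 P.left.2 = N.left.2 := h.left.2
  change VK.apply N.hom.1 (VK.apply h.left.1 P.left.2) = K
  rw [hw, N.apply_hom]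

end OfKnot

/-! ### Determined knots and components -/

theorem VK.mk_eq_mk_of_hom {U V : VK} (Ψ : U ⟶ V) (K : U.knots) :
    CategoryTheory.ConnectedComponents.mk (VK.forget.elementsMk U K) =
      CategoryTheory.ConnectedComponents.mk (VK.forget.elementsMk V (VK.apply Ψ K)) :=
  Quotient.sound (Zigzag.of_hom (⟨Ψ, rfl⟩ : VK.forget.elementsMk U K ⟶ _))

variable {A : GrothendieckTopology.Point.{1} VK.J}

/-- All knots determined by elements of the fibers of one point lie in one component. -/
theorem Determines.mk_eq_mk {U V : VK} {u : A.fiber.obj U} {v : A.fiber.obj V} {K : U.knots}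
    {L : V.knots} (hK : Determines A.fiber u K) (hL : Determines A.fiber v L) :
    CategoryTheory.ConnectedComponents.mk (VK.forget.elementsMk U K) =
      CategoryTheory.ConnectedComponents.mk (VK.forget.elementsMk V L) := by
  obtain ⟨W, f, g, w, rfl, rfl⟩ := exists_map_eq_map u v
  obtain ⟨M, hM⟩ := exists_determines w
  rw [hK.eq (hM.map f), hL.eq (hM.map g), ← VK.mk_eq_mk_of_hom, ← VK.mk_eq_mk_of_hom]

/-- The knots determined by elements of the fibers of a point fill a component. -/
theorem Determines.exists_of_mk_eq_mk {U V : VK} {u : A.fiber.obj U} {K : U.knots} {L : V.knots}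
    (hK : Determines A.fiber u K)
    (h : CategoryTheory.ConnectedComponents.mk (VK.forget.elementsMk U K) =
      CategoryTheory.ConnectedComponents.mk (VK.forget.elementsMk V L)) :
    ∃ v : A.fiber.obj V, Determines A.fiber v L := by
  have hz : Zigzag (VK.forget.elementsMk U K) (VK.forget.elementsMk V L) := Quotient.exact h
  suffices H : ∀ e : VK.forget.Elements, Zigzag (VK.forget.elementsMk U K) e →
      ∃ v : A.fiber.obj e.1, Determines A.fiber (U := e.1) v e.2 from H _ hz
  intro e he
  induction he with
  | refl => exact ⟨u, hK⟩
  | @tail e e' _ h ih =>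
    obtain ⟨v, hv⟩ := ih
    obtain ⟨⟨f⟩⟩ | ⟨⟨f⟩⟩ := h
    · have hf : VK.apply f.1 e.2 = e'.2 := f.2
      exact ⟨_, hf ▸ hv.map f.1⟩
    · have hf : VK.apply f.1 e'.2 = e.2 := f.2
      obtain ⟨w, -, hw⟩ := (hf.symm ▸ hv : Determines A.fiber v (VK.apply f.1 e'.2)).exists_map_eq
      exact ⟨w, hw⟩

theorem Determines.congr_iso {A B : VK ⥤ Type 1} (i : A ≅ B) {U : VK} {u : A.obj U} {K : U.knots}
    (hK : Determines A u K) : Determines B (i.hom.app U u) K := by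
  refine Eq.trans ?_ hK
  have h (V : VK) (Ψ : V ⟶ U) : (∃ v, B.map Ψ v = i.hom.app U u) ↔ ∃ v, A.map Ψ v = u := by
    constructor
    · rintro ⟨v, hv⟩
      refine ⟨i.inv.app V v, ?_⟩
      rw [← NatTrans.naturality_apply, hv]
      simp
    · rintro ⟨v, rfl⟩
      exact ⟨i.hom.app V v, (NatTrans.naturality_apply i.hom Ψ v).symm⟩
  simp only [h]

theorem exists_point_determines (c : VariableSpaceKnot) :
    ∃ (p : GeometricMorphism (Type 1) VKTopos) (U : VK) (K : U.knots) (u : (fiber p).obj U),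
      CategoryTheory.ConnectedComponents.mk (VK.forget.elementsMk U K) = c ∧
        Determines (fiber p) u K := by
  obtain ⟨⟨U, K⟩, rfl⟩ := Quotient.exists_rep c
  obtain ⟨u, hu⟩ := exists_determines_knotPoint K
  exact ⟨.ofPoint (knotPoint K), U, K, _, rfl,
    hu.congr_iso (GeometricMorphism.toPointOfPointIso.{0, 1} _).symm⟩

end VirtualKnots

end

open VirtualKnots in
/-- Variable-space knots are in one-to-one correspondence with virtual knots: the virtual knot of a
point `p` corresponds to the component formed by the `(U, K)` such that `K` is determined by some
element of the fiber of `p` at `U`. -/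
theorem mainTheorem2 :
    ∃ e : VirtualKnot ≃ VariableSpaceKnot,
      ∀ (p : GeometricMorphism (Type 1) VKTopos) (U : VK) (K : U.knots),
        CategoryTheory.ConnectedComponents.mk (VK.forget.elementsMk U K) = e (Quotient.mk _ p) ↔
          ∃ u : (fiber p).obj U, Determines (fiber p) u K := by
  -- the fiber functor of the point `Φ p` is `fiber p` by definition
  let Φ (p : GeometricMorphism (Type 1) VKTopos) : GrothendieckTopology.Point.{1} VK.J :=
    GeometricMorphism.toPoint.{0, 1} p
  have hex (p : GeometricMorphism (Type 1) VKTopos) :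
      ∃ (U : VK) (K : U.knots) (u : (Φ p).fiber.obj U), Determines (Φ p).fiber u K := by
    obtain ⟨⟨U, u⟩⟩ := IsCofiltered.nonempty (C := (Φ p).fiber.Elements)
    obtain ⟨K, hK⟩ := exists_determines u
    exact ⟨U, K, u, hK⟩
  choose U K u hu using hex
  let c (p : GeometricMorphism (Type 1) VKTopos) : VariableSpaceKnot :=
    CategoryTheory.ConnectedComponents.mk (VK.forget.elementsMk (U p) (K p))
  have hc (p : GeometricMorphism (Type 1) VKTopos) {V : VK} (L : V.knots) :
      CategoryTheory.ConnectedComponents.mk (VK.forget.elementsMk V L) = c p ↔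
        ∃ v : (Φ p).fiber.obj V, Determines (Φ p).fiber v L :=
    ⟨fun h => (hu p).exists_of_mk_eq_mk h.symm, fun ⟨_, hv⟩ => hv.mk_eq_mk (hu p)⟩
  have hcongr (p q : GeometricMorphism (Type 1) VKTopos) (h : IsIsomorphic p q) : c p = c q := by
    obtain ⟨i⟩ := h
    let j : p.inverseImage ≅ q.inverseImage := ⟨i.hom, i.inv, i.hom_inv_id, i.inv_hom_id⟩
    let k : (Φ p).fiber ≅ (Φ q).fiber :=
      Functor.isoWhiskerLeft uliftYoneda.{1}
        (Functor.isoWhiskerLeft (presheafToSheaf VK.J (Type 1)) j)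
    exact (hc q (K p)).2 ⟨_, (hu p).congr_iso k⟩
  let e : VirtualKnot → VariableSpaceKnot := Quotient.lift c hcongr
  have he : Function.Bijective e := by
    constructor
    · rintro ⟨p⟩ ⟨q⟩ h
      obtain ⟨w, hw⟩ := (hc q (K p)).1 h
      obtain ⟨i⟩ := (hu p).nonempty_iso hw
      exact Quotient.sound (GeometricMorphism.nonempty_iso_of_fiber_iso.{0, 1} p q i)
    · intro d
      obtain ⟨p, V, L, v, rfl, hv⟩ := exists_point_determines d
      exact ⟨Quotient.mk _ p, ((hc p L).2 ⟨v, hv⟩).symm⟩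
  exact ⟨Equiv.ofBijective e he, fun p V L => hc p L⟩
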